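/- Let $n\ge 6$ and let $G=K_4\square K_n$ be the $4\times n$ rook's graph, i.e. the Cartesian product of the complete graphs on $4$ and on $n$ vertices. Write $\operatorname{tw}$ for treewidth. A triangulation of $G$ is a chordal graph $H$ on the vertex set of $G$ that contains every edge of $G$; it is a minimum triangulation if no triangulation of $G$ has fewer edges. Let $$\tau(G)=\min\{\operatorname{tw}(H)-\operatorname{tw}(G) : H \text{ is a minimum triangulation of } G\}.$$ Then $\operatorname{tw}(G)=2n+1$, and there is no minimum triangulation $H^*$ of $G$ with $\operatorname{tw}(H^*)=\operatorname{tw}(G)$. Consequently $\tau(G)>0$. -/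

import Mathlib

/-- A graph is chordal if every cycle of length at least four has a chord: an edge of the graph
between two vertices of the cycle that is not an edge of the cycle. -/
def IsChordalGraph {V : Type*} (G : SimpleGraph V) : Prop :=
  ∀ (v : V) (c : G.Walk v v), c.IsCycle → 4 ≤ c.length →
    ∃ x ∈ c.support, ∃ y ∈ c.support, G.Adj x y ∧ s(x, y) ∉ c.edges

/-- `H` is a triangulation of `G`: a chordal supergraph of `G` on the same vertex set. -/
def IsTriangulation {V : Type*} (G H : SimpleGraph V) : Prop :=
  G ≤ H ∧ IsChordalGraph H

/-- `H` is a minimum triangulation of `G`: a triangulation with the fewest edges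
(used for finite graphs). -/
def IsMinimumTriangulation {V : Type*} (G H : SimpleGraph V) : Prop :=
  IsTriangulation G H ∧
    ∀ H' : SimpleGraph V, IsTriangulation G H' → H.edgeSet.ncard ≤ H'.edgeSet.ncard

/-- `(T, bag)` is a tree decomposition of `G`. -/
structure IsTreeDecomposition {V ι : Type*} (G : SimpleGraph V) (T : SimpleGraph ι)
    (bag : ι → Finset V) : Prop where
  isTree : T.IsTree
  exists_mem : ∀ v : V, ∃ t : ι, v ∈ bag t
  exists_mem_of_adj : ∀ u v : V, G.Adj u v → ∃ t : ι, u ∈ bag t ∧ v ∈ bag t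
  connected : ∀ v : V, (T.induce {t : ι | v ∈ bag t}).Connected

/-- The treewidth of a finite graph: the least `k` such that there is a (finite) tree
decomposition all of whose bags have at most `k + 1` vertices. -/
noncomputable def treewidth {V : Type*} (G : SimpleGraph V) : ℕ :=
  sInf {k : ℕ | ∃ (m : ℕ) (T : SimpleGraph (Fin m)) (bag : Fin m → Finset V),
    IsTreeDecomposition G T bag ∧ ∀ t : Fin m, (bag t).card ≤ k + 1}

/-- The parameter `τ(G)` of a finite graph: the least value of `tw(H) - tw(G)` over all minimum
triangulations `H` of `G`. The difference `d` is written additively; it is a natural number,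
since `G` is a subgraph of `H`. -/
noncomputable def tau {V : Type*} (G : SimpleGraph V) : ℕ :=
  sInf {d : ℕ | ∃ H : SimpleGraph V, IsMinimumTriangulation G H ∧
    treewidth H = treewidth G + d}

/-- The `m × n` rook's graph, the Cartesian product of the complete graphs on `m` and on `n`
vertices. -/
def rookGraph (m n : ℕ) : SimpleGraph (Fin m × Fin n) :=
  (⊤ : SimpleGraph (Fin m)).boxProd (⊤ : SimpleGraph (Fin n))

/-!
The argument compares the number of edges of two kinds of triangulations of `G = K₄ □ Kₙ`.

Two rows `r ≠ s` and two columns `i ≠ j` span a four-cycle of `G`, with diagonals `(r, i)(s, j)` and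
`(r, j)(s, i)`. A chordal supergraph contains at least one of the two, and different four-cycles
have different diagonals. Hence a triangulation has `5n² + n + D` edges, where `D` is the number of
four-cycles both of whose diagonals are present, and triangulations are compared through `D`
(`four_mul_ncard_edgeSet`).

*Small cliques force many double diagonals.* Let `H` be a chordal supergraph of `G`. A lobe of `H`
is a nonempty connected vertex set whose outer boundary is a clique; chordality provides a vertex of
the lobe adjacent to the whole boundary (`IsLobe.exists_forall_adj`). Two lobes which each meet
three of the four rows share a row, so considering one of least size gives a clique `B` such that
every component of `H - B` meets at most two rows (`exists_isClique_forall_card_rows_le_two`). A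
lobe `X` contained in two rows `a`, `b`, meeting both, and occupying `p` columns has in its boundary
the rest of these rows and the `2p` other vertices of its columns, so there is a clique of size `2n
+ 2p + 1 - |X|`. If all cliques have at most `2n + 2` vertices, then `|X| ≥ 2p - 1`, and vertices
can be removed from `X` one at a time until `p ≤ 2`; the boundary then contains rows `a` and `b` on
at least `n - 2` columns. As `B` leaves at least `2n - 2` vertices uncovered, a count of the
components of `H - B` yields two disjoint pairs of rows which are cliques on at least `n - 2`
columns (`exists_two_isClique_product`), so `D ≥ (n - 2)(n - 3)`. If all cliques had at most `2n +
1` vertices, then `|X| = 2p` for every such lobe, which by parity forces `p = 1`, and too few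
vertices are left uncovered by `B`. So every triangulation has a clique of size `2n + 2`, whence
`tw(G) ≥ 2n + 1`; sweeping the columns gives equality (`treewidth_rookGraph_four`).

*A triangulation with larger cliques and fewer edges.* Assign the columns to the four rows according
to the residue modulo `4` and let each row eliminate its own columns first. What remains has about
`3n` vertices and can be completed to two overlapping cliques of size about `5n/2`. In this
triangulation `2D ≤ n² - 3n + 2` (`four_mul_ncard_edgeSet_thinTriangulation_le`), and `(n² - 3n + 2)
/ 2 < (n - 2)(n - 3)` for `n ≥ 6`, because the difference is `(n - 2)(n - 5) / 2`.

A graph `H` of treewidth `2n + 1` has no clique with more than `2n + 2` vertices, since every clique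
lies in a bag of any tree decomposition of `H`. Hence no minimum triangulation has treewidth
`tw(G)`.
-/

open SimpleGraph

/-! ### Chordal graphs: elimination ranks and common neighbours along walks -/

/-- A cycle can be rotated to start at a vertex of least rank. -/
theorem SimpleGraph.Walk.IsCycle.exists_rotation_min {V : Type*} {H : SimpleGraph V} (ρ : V → ℕ)
    {a : V} {c : H.Walk a a} (hc : c.IsCycle) :
    ∃ (u : V) (d : H.Walk u u), d.IsCycle ∧ d.length = c.length ∧
      (∀ x, x ∈ d.support ↔ x ∈ c.support) ∧ (∀ e, e ∈ d.edges ↔ e ∈ c.edges) ∧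
      ∀ v ∈ d.support, ρ u ≤ ρ v := by
  classical
  obtain ⟨u, hu, hmin⟩ := Finset.exists_min_image c.support.toFinset ρ ⟨a, by simp⟩
  rw [List.mem_toFinset] at hu
  have hs : ∀ x, x ∈ (c.rotate u hu).support ↔ x ∈ c.support :=
    fun x => Walk.mem_support_rotate_iff c u hu
  exact ⟨u, c.rotate u hu, (Walk.isCycle_rotate hu).2 hc, Walk.length_rotate c u hu, hs,
    fun e => (Walk.rotate_edges c u hu).mem_iff,
    fun v hv => hmin v (by rwa [List.mem_toFinset, ← hs])⟩

/-- A graph is acyclic if every vertex has at most one neighbour of rank at least its own: a vertex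
of least rank on a cycle would have two. -/
theorem SimpleGraph.IsAcyclic.of_rank {V : Type*} {H : SimpleGraph V} (ρ : V → ℕ)
    (h : ∀ u v w, H.Adj u v → H.Adj u w → ρ u ≤ ρ v → ρ u ≤ ρ w → v = w) : H.IsAcyclic := by
  intro a c hc
  obtain ⟨u, d, hd, -, -, -, hmin⟩ := hc.exists_rotation_min ρ
  exact hd.snd_ne_penultimate (h u _ _ (Walk.adj_snd hd.not_nil)
    (Walk.adj_penultimate hd.not_nil).symm (hmin _ (Walk.getVert_mem_support _ _))
    (hmin _ (Walk.getVert_mem_support _ _)))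

/-- A perfect elimination order, with ties allowed, makes a graph chordal: the two neighbours, on a
long cycle, of a vertex of least rank are the ends of a chord. -/
theorem IsChordalGraph.of_rank {V : Type*} {H : SimpleGraph V} (ρ : V → ℕ)
    (h : ∀ u v w, H.Adj u v → H.Adj u w → v ≠ w → ρ u ≤ ρ v → ρ u ≤ ρ w → H.Adj v w) :
    IsChordalGraph H := by
  intro a c hc hlen
  obtain ⟨u, d, hd, hl, hs, he, hmin⟩ := hc.exists_rotation_min ρ
  rw [← hl] at hlen
  have hne : ¬ d.Nil := hd.not_nil
  refine ⟨d.snd, (hs _).1 (Walk.getVert_mem_support _ _), d.penultimate,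
    (hs _).1 (Walk.getVert_mem_support _ _), ?_, ?_⟩
  · exact h u _ _ (Walk.adj_snd hne) (Walk.adj_penultimate hne).symm hd.snd_ne_penultimate
      (hmin _ (Walk.getVert_mem_support _ _)) (hmin _ (Walk.getVert_mem_support _ _))
  · rw [← he, Walk.mk_mem_edges_iff_exists]
    rintro ⟨i, hi, he⟩
    have key : ∀ i j, 1 ≤ i → i ≤ d.length → 1 ≤ j → j ≤ d.length →
        d.getVert i = d.getVert j → i = j := fun i j h1 h2 h3 h4 h =>
      hd.getVert_injOn ⟨h1, h2⟩ ⟨h3, h4⟩ h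
    have h0 : d.getVert 0 = d.getVert d.length := by simp
    rw [Sym2.eq_iff] at he
    rcases Nat.eq_zero_or_pos i with rfl | hi0
    · rw [h0] at he
      rcases he with ⟨h1, h2⟩ | ⟨h1, h2⟩
      · have := key _ _ (by lia) le_rfl le_rfl (by lia) h1
        lia
      · have := key _ _ (by lia) (by lia) (by lia) (by lia) h1
        lia
    · rcases he with ⟨h1, h2⟩ | ⟨h1, h2⟩
      · have := key _ _ (by lia) (by lia) (by lia) (by lia) h1
        have := key _ _ (by lia) (by lia) (by lia) (by lia) h2
        lia
      · have := key _ _ (by lia) (by lia) (by lia) (by lia) h2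
        lia

/-- In a chordal graph, if the ends of an edge `xy` are adjacent to the two ends of a walk avoiding
`x` and `y`, then some vertex of the walk is adjacent to both. A shortest walk between a neighbour
of `x` and a neighbour of `y` would otherwise close up with `xy` to a chordless cycle. -/
theorem IsChordalGraph.exists_common_neighbor_of_walk {V : Type*} {H : SimpleGraph V}
    (hH : IsChordalGraph H) {x y : V} (hxy : H.Adj x y) {a b : V} (w : H.Walk a b)
    (hxa : H.Adj x a) (hyb : H.Adj y b) (hx : x ∉ w.support) (hy : y ∉ w.support) :
    ∃ z ∈ w.support, H.Adj x z ∧ H.Adj y z := by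
  induction hN : w.length using Nat.strong_induction_on generalizing a b with
  | _ N ih =>
  subst hN
  have step : ∀ {a' b' : V} (w' : H.Walk a' b'), w'.length < w.length →
      (∀ z ∈ w'.support, z ∈ w.support) → H.Adj x a' → H.Adj y b' →
      ∃ z ∈ w.support, H.Adj x z ∧ H.Adj y z := by
    intro a' b' w' hlt hsub h1 h2
    obtain ⟨z, hz, h⟩ := ih _ hlt w' h1 h2 (fun h => hx (hsub _ h)) (fun h => hy (hsub _ h)) rfl
    exact ⟨z, hsub _ hz, h⟩
  have htake : ∀ i, ∀ z ∈ (w.take i).support, z ∈ w.support := fun i z hz => by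
    rw [Walk.support_take] at hz
    exact List.mem_of_mem_take hz
  have hdrop : ∀ i, ∀ z ∈ (w.drop i).support, z ∈ w.support := fun i z hz => by
    rw [Walk.mem_support_iff_exists_getVert] at hz
    obtain ⟨n, rfl, -⟩ := hz
    rw [Walk.drop_getVert]
    exact Walk.getVert_mem_support _ _
  -- From here on the walk is a shortest one, so it is an induced path.
  by_contra hcon
  have hlen : w.length ≠ 0 := by
    intro h0
    have := Walk.eq_of_length_eq_zero h0
    subst this
    exact hcon ⟨a, by simp, hxa, hyb⟩
  have h1 : ∀ i, 0 < i → i ≤ w.length → ¬ H.Adj x (w.getVert i) := fun i h0 hi h =>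
    hcon (step (w.drop i) (by simp; lia) (hdrop i) h hyb)
  have h2 : ∀ i, i < w.length → ¬ H.Adj y (w.getVert i) := fun i hi h =>
    hcon (step (w.take i) (by simp; lia) (htake i) hxa h)
  have h3 : ∀ i j, i + 1 < j → j ≤ w.length → ¬ H.Adj (w.getVert i) (w.getVert j) := by
    intro i j hij hj h
    refine hcon (step ((w.take i).append (Walk.cons h (w.drop j))) (by simp; lia) ?_ hxa hyb)
    intro z hz
    rw [Walk.mem_support_append_iff, Walk.support_cons, List.mem_cons] at hz
    rcases hz with hz | rfl | hz
    · exact htake _ _ hz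
    · exact Walk.getVert_mem_support _ _
    · exact hdrop _ _ hz
  have h4 : ∀ i j, i < j → j ≤ w.length → w.getVert i ≠ w.getVert j := by
    intro i j hij hj h
    refine hcon (step ((w.take i).append ((w.drop j).copy h.symm rfl)) (by simp; lia) ?_ hxa hyb)
    intro z hz
    rw [Walk.mem_support_append_iff, Walk.support_copy] at hz
    exact hz.elim (htake _ _) (hdrop _ _)
  have hpath : w.IsPath := by
    rw [← Walk.IsPath.getVert_injOn_iff]
    intro i hi j hj h
    rcases lt_trichotomy i j with hij | hij | hij
    · exact absurd h (h4 i j hij hj)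
    · exact hij
    · exact absurd h.symm (h4 j i hij hi)
  have hxney := hxy.ne
  have hcyc : (Walk.cons hxy.symm (Walk.cons hxa (w.concat hyb.symm))).IsCycle := by
    rw [Walk.cons_isCycle_iff, Walk.cons_isPath_iff, Walk.concat_isPath_iff]
    refine ⟨⟨⟨hpath, hy⟩, ?_⟩, ?_⟩
    · simp [Walk.support_concat, hx, hxney]
    · simp only [Walk.edges_cons, Walk.edges_concat, List.mem_cons, List.concat_eq_append,
        List.mem_append, List.not_mem_nil, or_false]
      rintro (h | h | h)
      · rw [Sym2.eq_iff] at h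
        rcases h with ⟨h, -⟩ | ⟨h, -⟩
        · exact hxney h.symm
        · exact hy (h ▸ w.start_mem_support)
      · exact hx (w.snd_mem_support_of_mem_edges h)
      · rw [Sym2.eq_iff] at h
        rcases h with ⟨-, h⟩ | ⟨-, h⟩
        · exact hxney h
        · exact hx (h ▸ w.end_mem_support)
  obtain ⟨p, hp, q, hq, hpq, hno⟩ := hH y _ hcyc (by simp; lia)
  simp only [Walk.support_cons, Walk.support_concat, List.mem_cons, List.concat_eq_append,
    List.mem_append, List.not_mem_nil, or_false, Walk.edges_cons, Walk.edges_concat,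
    not_or] at hp hq hno
  obtain ⟨hn1, hn2, hn3, hn4⟩ := hno
  have hw0 : w.getVert 0 = a := by simp
  have hwl : w.getVert w.length = b := by simp
  have X : ∀ z ∈ w.support, H.Adj x z → z = a := by
    intro z hz h
    obtain ⟨i, rfl, hi⟩ := Walk.mem_support_iff_exists_getVert.1 hz
    rcases Nat.eq_zero_or_pos i with rfl | h0
    · simp
    · exact absurd h (h1 i h0 hi)
  have Y : ∀ z ∈ w.support, H.Adj y z → z = b := by
    intro z hz h
    obtain ⟨i, rfl, hi⟩ := Walk.mem_support_iff_exists_getVert.1 hz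
    rcases hi.lt_or_eq with h0 | rfl
    · exact absurd h (h2 i h0)
    · simp
  have W : ∀ p ∈ w.support, ∀ q ∈ w.support, H.Adj p q → s(p, q) ∈ w.edges := by
    intro p hp q hq h
    obtain ⟨i, rfl, hi⟩ := Walk.mem_support_iff_exists_getVert.1 hp
    obtain ⟨j, rfl, hj⟩ := Walk.mem_support_iff_exists_getVert.1 hq
    rw [Walk.mk_mem_edges_iff_exists]
    rcases lt_trichotomy i j with hij | hij | hij
    · rcases (Nat.succ_le_of_lt hij).lt_or_eq with hlt | rfl
      · exact absurd h (h3 i j hlt hj)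
      · exact ⟨i, by lia, rfl⟩
    · subst hij
      exact absurd h (H.irrefl)
    · rcases (Nat.succ_le_of_lt hij).lt_or_eq with hlt | rfl
      · exact absurd h.symm (h3 j i hlt hi)
      · exact ⟨j, by lia, Sym2.eq_swap⟩
  have C1 : ∀ z, z = y ∨ z = x ∨ z ∈ w.support ∨ z = y → z = x ∨ z = y ∨ z ∈ w.support := by
    tauto
  replace hp := C1 p hp
  replace hq := C1 q hq
  rcases hp with rfl | rfl | hp <;> rcases hq with rfl | rfl | hq
  · exact hpq.ne rfl
  · exact hn1 Sym2.eq_swap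
  · exact hn2 (by rw [X q hq hpq])
  · exact hn1 rfl
  · exact hpq.ne rfl
  · exact hn4 (by rw [Y q hq hpq, Sym2.eq_swap])
  · exact hn2 (by rw [X p hp hpq.symm, Sym2.eq_swap])
  · exact hn4 (by rw [Y p hp hpq.symm])
  · exact hn3 (W p hp q hq hpq)

/-! ### Tree decompositions, treewidth and minimum triangulations -/

theorem SimpleGraph.exists_isPath_support_subset {V : Type*} {G : SimpleGraph V} {S : Set V}
    (hS : (G.induce S).Preconnected) {u v : V} (hu : u ∈ S) (hv : v ∈ S) :
    ∃ p : G.Walk u v, p.IsPath ∧ ∀ z ∈ p.support, z ∈ S := by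
  classical
  have key : ∀ (x y : S) (_ : (G.induce S).Walk x y),
      ∃ p : G.Walk (x : V) y, ∀ z ∈ p.support, z ∈ S := by
    intro x y p
    induction p with
    | nil => exact ⟨Walk.nil, by simp⟩
    | @cons x y _ h _ ih =>
      obtain ⟨p, hp⟩ := ih
      have h' : G.Adj (x : V) (y : V) := h
      refine ⟨Walk.cons h' p, fun z hz => ?_⟩
      rw [Walk.support_cons, List.mem_cons] at hz
      rcases hz with rfl | hz
      · exact x.2
      · exact hp z hz
  obtain ⟨w⟩ := hS ⟨u, hu⟩ ⟨v, hv⟩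
  obtain ⟨p, hp⟩ := key _ _ w
  exact ⟨p.bypass, p.bypass_isPath, fun z hz => hp z (p.support_bypass_subset_support hz)⟩

/-- Let two subtrees of a tree share a node `x`. If the top node (the node closest to the root `r`)
of the first is at most as far from `r` as that of the second, then the first subtree contains the
top node of the second: both top nodes lie on the path from `r` to `x`, and that path stays inside a
subtree from its top node on. -/
theorem SimpleGraph.IsTree.mem_of_dist_le {ι : Type*} {T : SimpleGraph ι} (hT : T.IsTree)
    (r : ι) {S₁ S₂ : Set ι} (h₁ : (T.induce S₁).Connected) (h₂ : (T.induce S₂).Connected)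
    {t₁ t₂ x : ι} (ht₁ : t₁ ∈ S₁) (ht₂ : t₂ ∈ S₂)
    (hm₁ : ∀ s ∈ S₁, T.dist r t₁ ≤ T.dist r s) (hm₂ : ∀ s ∈ S₂, T.dist r t₂ ≤ T.dist r s)
    (hx₁ : x ∈ S₁) (hx₂ : x ∈ S₂) (hle : T.dist r t₁ ≤ T.dist r t₂) : t₂ ∈ S₁ := by
  classical
  have key : ∀ (S : Set ι), (T.induce S).Connected → ∀ t ∈ S,
      (∀ s ∈ S, T.dist r t ≤ T.dist r s) → x ∈ S →
      ∃ (q : T.Walk r t) (p : T.Walk t x), q.length = T.dist r t ∧ (∀ z ∈ p.support, z ∈ S) ∧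
        (q.append p).IsPath := by
    intro S hS t ht hm hx
    obtain ⟨q, hq⟩ := hT.connected.exists_walk_length_eq_dist r t
    obtain ⟨p, hp, hsub⟩ := exists_isPath_support_subset hS.preconnected ht hx
    refine ⟨q, p, hq, hsub, ?_⟩
    · have hqp : q.IsPath := Walk.isPath_of_length_eq_dist q hq
      rw [Walk.isPath_def, Walk.support_append, List.nodup_append']
      refine ⟨hqp.support_nodup, hp.support_nodup.tail, ?_⟩
      intro z hz hz'
      have hzS : z ∈ S := hsub z (List.mem_of_mem_tail hz')
      have hzt : z = t := by
        by_contra hne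
        have h3 : T.dist r z ≤ (q.takeUntil z hz).length := dist_le _
        have h4 : (q.takeUntil z hz).length < q.length := Walk.length_takeUntil_lt_length hz hne
        have := hm z hzS
        lia
      subst hzt
      have := hp.support_nodup
      rw [← Walk.cons_tail_support, List.nodup_cons] at this
      exact this.1 hz'
  obtain ⟨q₁, p₁, hq₁, hs₁, hP₁⟩ := key S₁ h₁ t₁ ht₁ hm₁ hx₁
  obtain ⟨q₂, p₂, hq₂, -, hP₂⟩ := key S₂ h₂ t₂ ht₂ hm₂ hx₂
  have heq : q₁.append p₁ = q₂.append p₂ :=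
    (hT.existsUnique_path r x).unique hP₁ hP₂
  have h5 : (q₂.append p₂).getVert q₂.length = t₂ := by
    rw [Walk.getVert_append]; simp
  rw [← heq, Walk.getVert_append, if_neg (by lia)] at h5
  exact hs₁ _ (h5 ▸ Walk.getVert_mem_support _ _)

/-- The graph in which two distinct vertices are adjacent when some bag contains both. -/
def bagGraph {V ι : Type*} (bag : ι → Finset V) : SimpleGraph V where
  Adj u v := u ≠ v ∧ ∃ t, u ∈ bag t ∧ v ∈ bag t
  symm := ⟨fun _ _ ⟨h, t, h1, h2⟩ => ⟨h.symm, t, h2, h1⟩⟩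
  loopless := ⟨fun _ h => h.1 rfl⟩

namespace IsTreeDecomposition

variable {V ι : Type*} {G : SimpleGraph V} {T : SimpleGraph ι} {bag : ι → Finset V}

theorem exists_top (h : IsTreeDecomposition G T bag) (r : ι) (v : V) :
    ∃ t, v ∈ bag t ∧ ∀ s, v ∈ bag s → T.dist r t ≤ T.dist r s := by
  classical
  obtain ⟨t, ht⟩ := h.exists_mem v
  obtain ⟨t', h1, h2⟩ := WellFounded.has_min (measure (T.dist r)).wf {t | v ∈ bag t} ⟨t, ht⟩
  exact ⟨t', h1, fun s hs => not_lt.1 (h2 s hs)⟩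

/-- Every vertex `v` gets the top node `top v` of its subtree and the depth `d v` of that node; of
two vertices sharing a bag, the one of smaller depth lies in the bag at the top of the other. -/
theorem exists_rank (h : IsTreeDecomposition G T bag) :
    ∃ (top : V → ι) (d : V → ℕ), (∀ v, v ∈ bag (top v)) ∧
      ∀ u v, (bagGraph bag).Adj u v → d u ≤ d v → u ∈ bag (top v) := by
  obtain ⟨r⟩ := h.isTree.connected.nonempty
  choose top htop hmin using h.exists_top r
  refine ⟨top, fun v => T.dist r (top v), htop, ?_⟩
  rintro u v ⟨-, x, hxu, hxv⟩ hle
  exact h.isTree.mem_of_dist_le r (h.connected u) (h.connected v) (htop u) (htop v) (hmin u)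
    (hmin v) hxu hxv hle

theorem le_bagGraph (h : IsTreeDecomposition G T bag) : G ≤ bagGraph bag :=
  fun u v huv => ⟨huv.ne, h.exists_mem_of_adj u v huv⟩

/-- Helly property: a clique lies in the bag at the deepest top node of its vertices. -/
theorem isClique_subset_bag [Nonempty V] (h : IsTreeDecomposition G T bag) {K : Finset V}
    (hK : (bagGraph bag).IsClique K) : ∃ t, K ⊆ bag t := by
  obtain ⟨top, d, htop, hd⟩ := h.exists_rank
  rcases K.eq_empty_or_nonempty with rfl | hne
  · exact ⟨top (Classical.arbitrary V), by simp⟩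
  · obtain ⟨v, hv, hmax⟩ := Finset.exists_max_image K d hne
    refine ⟨top v, fun u hu => ?_⟩
    by_cases huv : u = v
    · exact huv ▸ htop v
    · exact hd u v (hK hu hv huv) (hmax u hu)

/-- Eliminating vertices in order of decreasing depth of their top nodes is a perfect elimination
order. -/
theorem isChordalGraph_bagGraph [Finite V] (h : IsTreeDecomposition G T bag) :
    IsChordalGraph (bagGraph bag) := by
  obtain ⟨top, d, htop, hd⟩ := h.exists_rank
  have := Fintype.ofFinite V
  have hle : ∀ v, d v ≤ Finset.univ.sup d := fun v => Finset.le_sup (Finset.mem_univ v)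
  refine IsChordalGraph.of_rank (fun v => Finset.univ.sup d - d v) ?_
  intro u v w huv huw hvw h1 h2
  have := hle u; have := hle v; have := hle w
  exact ⟨hvw, top u, hd v u huv.symm (by lia), hd w u huw.symm (by lia)⟩

theorem mono {G' : SimpleGraph V} (hG : G ≤ G') (h : IsTreeDecomposition G' T bag) :
    IsTreeDecomposition G T bag :=
  ⟨h.isTree, h.exists_mem, fun u v huv => h.exists_mem_of_adj u v (hG huv), h.connected⟩

end IsTreeDecomposition

theorem exists_isTreeDecomposition_card_le_treewidth {V : Type*} [Finite V] (G : SimpleGraph V) :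
    ∃ (m : ℕ) (T : SimpleGraph (Fin m)) (bag : Fin m → Finset V),
      IsTreeDecomposition G T bag ∧ ∀ t : Fin m, (bag t).card ≤ treewidth G + 1 := by
  have := Fintype.ofFinite V
  refine Nat.sInf_mem (s := {k : ℕ | ∃ (m : ℕ) (T : SimpleGraph (Fin m)) (bag : Fin m → Finset V),
    IsTreeDecomposition G T bag ∧ ∀ t : Fin m, (bag t).card ≤ k + 1}) ?_
  refine ⟨Fintype.card V, 1, ⊥, fun _ => Finset.univ, ⟨IsTree.of_subsingleton, by simp, by simp,
    fun v => ?_⟩, fun t => ?_⟩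
  · have : Nonempty {t : Fin 1 | v ∈ (Finset.univ : Finset V)} := ⟨⟨0, by simp⟩⟩
    exact ⟨.of_subsingleton⟩
  · rw [Finset.card_univ]; lia

theorem treewidth_le_of_isTreeDecomposition {V : Type*} {G : SimpleGraph V} {m k : ℕ}
    {T : SimpleGraph (Fin m)} {bag : Fin m → Finset V} (h : IsTreeDecomposition G T bag)
    (hk : ∀ t : Fin m, (bag t).card ≤ k + 1) : treewidth G ≤ k :=
  Nat.sInf_le ⟨m, T, bag, h, hk⟩

theorem treewidth_mono {V : Type*} [Finite V] {G H : SimpleGraph V} (hle : G ≤ H) :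
    treewidth G ≤ treewidth H := by
  obtain ⟨m, T, bag, h, hk⟩ := exists_isTreeDecomposition_card_le_treewidth H
  exact treewidth_le_of_isTreeDecomposition (h.mono hle) hk

/-- The sharing graph of the bags of an optimal tree decomposition is a triangulation without large
cliques. Applied to a graph and its own cliques, this bounds the clique number by the treewidth. -/
theorem exists_isTriangulation_isClique_card_le_treewidth {V : Type*} [Finite V] [Nonempty V]
    (G : SimpleGraph V) : ∃ H, IsTriangulation G H ∧
      ∀ K : Finset V, H.IsClique K → K.card ≤ treewidth G + 1 := by
  obtain ⟨m, T, bag, h, hk⟩ := exists_isTreeDecomposition_card_le_treewidth G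
  refine ⟨bagGraph bag, ⟨h.le_bagGraph, h.isChordalGraph_bagGraph⟩, fun K hK => ?_⟩
  obtain ⟨t, ht⟩ := h.isClique_subset_bag hK
  exact (Finset.card_le_card ht).trans (hk t)

theorem exists_isMinimumTriangulation {V : Type*} [Finite V] (G : SimpleGraph V) :
    ∃ H, IsMinimumTriangulation G H := by
  have htop : IsTriangulation G ⊤ :=
    ⟨le_top, IsChordalGraph.of_rank 0 fun u v w _ _ hvw _ _ => hvw⟩
  obtain ⟨H, h1, h2⟩ := WellFounded.has_min
    (measure fun H : SimpleGraph V => H.edgeSet.ncard).wf {H | IsTriangulation G H} ⟨_, htop⟩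
  exact ⟨H, h1, fun H' h' => not_lt.1 (h2 H' h')⟩

/-- Since a minimum triangulation exists, the infimum defining `tau` is attained, so it is not the
value `0` of an empty infimum. -/
theorem tau_pos {V : Type*} [Finite V] {G : SimpleGraph V}
    (h : ¬ ∃ H, IsMinimumTriangulation G H ∧ treewidth H = treewidth G) : 0 < tau G := by
  obtain ⟨H, hH⟩ := exists_isMinimumTriangulation G
  have hle := treewidth_mono hH.1.1
  have hmem : tau G ∈ {d : ℕ | ∃ H : SimpleGraph V, IsMinimumTriangulation G H ∧
      treewidth H = treewidth G + d} := Nat.sInf_mem ⟨treewidth H - treewidth G, H, hH, by lia⟩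
  refine Nat.pos_of_ne_zero fun h0 => h ?_
  rw [h0] at hmem
  exact hmem

/-! ### Lobes of chordal graphs -/

section Lobes

variable {V : Type*} {H : SimpleGraph V}

/-- The set `X` is connected: any two of its vertices are joined by a walk inside `X`. The empty set
qualifies. -/
def IsWalkConnected (H : SimpleGraph V) (X : Finset V) : Prop :=
  ∀ u ∈ X, ∀ v ∈ X, ∃ w : H.Walk u v, ∀ z ∈ w.support, z ∈ X

/-- The vertices outside `X` with a neighbour in `X`. -/
def outerBoundary (H : SimpleGraph V) (X : Finset V) : Set V :=
  {z | z ∉ X ∧ ∃ x ∈ X, H.Adj x z}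

/-- A nonempty connected vertex set whose outer boundary is a clique. -/
structure IsLobe (H : SimpleGraph V) (X : Finset V) : Prop where
  nonempty : X.Nonempty
  isWalkConnected : IsWalkConnected H X
  isClique_outerBoundary : H.IsClique (outerBoundary H X)

/-- A walk ending at a neighbour of `b` can be cut at the first neighbour of `b` on it. -/
theorem SimpleGraph.Walk.exists_first_adj (b : V) {v x : V} (w : H.Walk v x) (hb : H.Adj b x) :
    ∃ (u : V) (w' : H.Walk v u), (∀ z ∈ w'.support, z ∈ w.support) ∧ H.Adj b u ∧
      ∀ z ∈ w'.support, H.Adj b z → z = u := by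
  induction w with
  | nil => exact ⟨_, Walk.nil, by simp, hb, by simp⟩
  | @cons v y x h p ih =>
    by_cases hv : H.Adj b v
    · exact ⟨v, Walk.nil, by simp, hv, by simp⟩
    · obtain ⟨u, w', h1, h2, h3⟩ := ih hb
      refine ⟨u, Walk.cons h w', ?_, h2, ?_⟩
      · intro z hz
        rw [Walk.support_cons, List.mem_cons] at hz ⊢
        exact hz.imp_right (h1 z)
      · intro z hz hbz
        rw [Walk.support_cons, List.mem_cons] at hz
        rcases hz with rfl | hz
        · exact absurd hbz hv
        · exact h3 z hz hbz

/-- In a chordal graph a lobe contains a vertex adjacent to its whole outer boundary, namely any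
vertex with the most neighbours there. -/
theorem IsLobe.exists_forall_adj [Finite V] (hH : IsChordalGraph H) {X : Finset V}
    (hX : IsLobe H X) : ∃ v ∈ X, ∀ z ∈ outerBoundary H X, H.Adj v z := by
  obtain ⟨v, hv, hmax⟩ := Finset.exists_max_image X
    (fun v => {z ∈ outerBoundary H X | H.Adj v z}.ncard) hX.nonempty
  refine ⟨v, hv, fun b hb => ?_⟩
  by_contra hvb
  obtain ⟨x, hx, hxb⟩ := hb.2
  obtain ⟨w, hw⟩ := hX.isWalkConnected v hv x hx
  -- The first neighbour `u` of `b` on the walk sees `b` and all boundary neighbours of `v`.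
  obtain ⟨u, w', h1, h2, h3⟩ := w.exists_first_adj b hxb.symm
  have hu : u ∈ X := hw u (h1 u w'.end_mem_support)
  refine absurd (hmax u hu) (not_le.2 (Set.ncard_lt_ncard ?_))
  refine ⟨?_, fun hsub => hvb (hsub ⟨hb, h2.symm⟩).2⟩
  rintro c ⟨hc, hvc⟩
  have hcb : H.Adj c b := hX.isClique_outerBoundary hc hb (by rintro rfl; exact hvb hvc)
  obtain ⟨z, hz, hcz, hbz⟩ := hH.exists_common_neighbor_of_walk hcb w' hvc.symm h2
    (fun h => hc.1 (hw _ (h1 _ h))) (fun h => hb.1 (hw _ (h1 _ h)))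
  exact ⟨hc, (h3 z hz hbz ▸ hcz).symm⟩

theorem SimpleGraph.Walk.mem_of_forall_notMem_outerBoundary {X : Finset V} {y z : V}
    (w : H.Walk y z) (hy : y ∈ X) (hw : ∀ s ∈ w.support, s ∉ outerBoundary H X) : z ∈ X := by
  induction w with
  | nil => exact hy
  | @cons a b c h p ih =>
    refine ih ?_ fun s hs => hw s (by simp [hs])
    by_contra hb
    exact hw b (by simp) ⟨hb, a, hy, h⟩

open Classical in
/-- The component of `u` in the graph `H - B`; it is empty when `u ∈ B`. -/
noncomputable def componentOff [Fintype V] (H : SimpleGraph V) (B : Finset V) (u : V) : Finset V :=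
  {z | ∃ w : H.Walk u z, ∀ s ∈ w.support, s ∉ B}

theorem mem_componentOff [Fintype V] {B : Finset V} {u z : V} :
    z ∈ componentOff H B u ↔ ∃ w : H.Walk u z, ∀ s ∈ w.support, s ∉ B := by
  simp [componentOff]

theorem self_mem_componentOff [Fintype V] {B : Finset V} {u : V} (hu : u ∉ B) :
    u ∈ componentOff H B u :=
  mem_componentOff.2 ⟨Walk.nil, by simpa using hu⟩

theorem notMem_of_mem_componentOff [Fintype V] {B : Finset V} {u z : V}
    (hz : z ∈ componentOff H B u) : z ∉ B := by
  obtain ⟨w, hw⟩ := mem_componentOff.1 hz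
  exact hw z w.end_mem_support

theorem mem_componentOff_of_adj [Fintype V] {B : Finset V} {u x z : V}
    (hx : x ∈ componentOff H B u) (hxz : H.Adj x z) (hz : z ∉ B) : z ∈ componentOff H B u := by
  obtain ⟨w, hw⟩ := mem_componentOff.1 hx
  refine mem_componentOff.2 ⟨w.concat hxz, fun s hs => ?_⟩
  rw [Walk.support_concat, List.mem_append, List.mem_singleton] at hs
  rcases hs with hs | rfl
  · exact hw s hs
  · exact hz

theorem isWalkConnected_componentOff [Fintype V] (B : Finset V) (u : V) :
    IsWalkConnected H (componentOff H B u) := by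
  classical
  intro x hx y hy
  obtain ⟨p, hp⟩ := mem_componentOff.1 hx
  obtain ⟨q, hq⟩ := mem_componentOff.1 hy
  have key : ∀ {t : V} (r : H.Walk u t), (∀ s ∈ r.support, s ∉ B) →
      ∀ z ∈ r.support, z ∈ componentOff H B u := fun r hr z hz =>
    mem_componentOff.2 ⟨r.takeUntil z hz, fun s hs => hr s (r.support_takeUntil_subset_support hz hs)⟩
  refine ⟨p.reverse.append q, fun z hz => ?_⟩
  rw [Walk.mem_support_append_iff, Walk.support_reverse, List.mem_reverse] at hz
  exact hz.elim (key p hp z) (key q hq z)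

theorem isLobe_componentOff [Fintype V] {B : Finset V} (hB : H.IsClique B) {u : V} (hu : u ∉ B) :
    IsLobe H (componentOff H B u) := by
  refine ⟨⟨u, self_mem_componentOff hu⟩, isWalkConnected_componentOff B u, hB.subset ?_⟩
  rintro z ⟨hz, x, hx, hxz⟩
  by_contra hzB
  exact hz (mem_componentOff_of_adj hx hxz hzB)

end Lobes

/-! ### Lobes of supergraphs of the rook's graph -/

section Rook

variable {n : ℕ} {H : SimpleGraph (Fin 4 × Fin n)}

theorem adj_of_fst_eq {m n : ℕ} {H : SimpleGraph (Fin m × Fin n)} (hG : rookGraph m n ≤ H)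
    {x y : Fin m × Fin n} (h : x.1 = y.1) (hne : x ≠ y) : H.Adj x y :=
  hG (Or.inr ⟨fun h2 => hne (Prod.ext h h2), h⟩)

theorem adj_of_snd_eq {m n : ℕ} {H : SimpleGraph (Fin m × Fin n)} (hG : rookGraph m n ≤ H)
    {x y : Fin m × Fin n} (h : x.2 = y.2) (hne : x ≠ y) : H.Adj x y :=
  hG (Or.inl ⟨fun h2 => hne (Prod.ext h2 h), h⟩)

/-- A central clique: removing it leaves components meeting at most two rows each. Otherwise take a
lobe `X` of least size meeting three rows, and the clique formed by its outer boundary and a vertex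
of `X` complete to it. A component off this clique meeting three rows shares a row with `X`, hence
lies in `X`, and it is smaller. -/
theorem exists_isClique_forall_card_rows_le_two (hG : rookGraph 4 n ≤ H) (hH : IsChordalGraph H) :
    ∃ B : Finset (Fin 4 × Fin n), H.IsClique B ∧
      ∀ u ∉ B, ((componentOff H B u).image Prod.fst).card ≤ 2 := by
  classical
  by_contra! hcon
  obtain ⟨u₀, hu₀, hc₀⟩ := hcon ∅ (by simp)
  obtain ⟨X, ⟨hX, hXr⟩, hmin⟩ := WellFounded.has_min
    (measure (Finset.card (α := Fin 4 × Fin n))).wf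
    {X | IsLobe H X ∧ 2 < (X.image Prod.fst).card} ⟨_, isLobe_componentOff (by simp) hu₀, hc₀⟩
  obtain ⟨v, hv, hvN⟩ := hX.exists_forall_adj hH
  have hB : H.IsClique (insert v (outerBoundary H X)) := by
    rw [isClique_insert]
    exact ⟨hX.isClique_outerBoundary, fun b hb _ => hvN b hb⟩
  have hB' : H.IsClique ((Set.toFinite (insert v (outerBoundary H X))).toFinset : Set _) := by
    simpa using hB
  obtain ⟨u, hu, hc⟩ := hcon _ hB'
  refine hmin _ ⟨isLobe_componentOff hB' hu, hc⟩ (Finset.card_lt_card ?_)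
  set B := (Set.toFinite (insert v (outerBoundary H X))).toFinset with hBdef
  have hmemB : ∀ z, z ∈ B ↔ z = v ∨ z ∈ outerBoundary H X := fun z => by simp [hBdef]
  obtain ⟨r, hr⟩ : (X.image Prod.fst ∩ (componentOff H B u).image Prod.fst).Nonempty := by
    rw [← Finset.card_pos]
    have h1 := Finset.card_union_add_card_inter (X.image Prod.fst)
      ((componentOff H B u).image Prod.fst)
    have h2 := Finset.card_le_univ (X.image Prod.fst ∪ (componentOff H B u).image Prod.fst)
    rw [Fintype.card_fin] at h2
    lia
  rw [Finset.mem_inter, Finset.mem_image, Finset.mem_image] at hr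
  obtain ⟨⟨x, hx, hxr⟩, y, hy, hyr⟩ := hr
  have hyB := notMem_of_mem_componentOff hy
  have hyX : y ∈ X := by
    by_contra hyX
    exact hyB ((hmemB y).2 (Or.inr ⟨hyX, x, hx, adj_of_fst_eq hG (hxr.trans hyr.symm)
      (by rintro rfl; exact hyX hx)⟩))
  refine ⟨fun z hz => ?_, fun hsub =>
    notMem_of_mem_componentOff (hsub hv) ((hmemB v).2 (Or.inl rfl))⟩
  obtain ⟨w, hw⟩ := isWalkConnected_componentOff B u y hy z hz
  exact w.mem_of_forall_notMem_outerBoundary hyX fun s hs hs' =>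
    notMem_of_mem_componentOff (hw s hs) ((hmemB s).2 (Or.inr hs'))

/-- A lobe contained in the rows `a` and `b` and meeting both of them. -/
structure IsTwoRowLobe (H : SimpleGraph (Fin 4 × Fin n)) (a b : Fin 4)
    (X : Finset (Fin 4 × Fin n)) : Prop extends IsLobe H X where
  fst_eq_or : ∀ x ∈ X, x.1 = a ∨ x.1 = b
  exists_left : ∃ j, (a, j) ∈ X
  exists_right : ∃ j, (b, j) ∈ X

namespace IsTwoRowLobe

variable {a b : Fin 4} {X : Finset (Fin 4 × Fin n)}

theorem card_le (hX : IsTwoRowLobe H a b X) : X.card ≤ 2 * (X.image Prod.snd).card := by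
  calc X.card ≤ (({a, b} : Finset (Fin 4)) ×ˢ X.image Prod.snd).card :=
        Finset.card_le_card fun x hx => Finset.mem_product.2
          ⟨by simpa using hX.fst_eq_or x hx, Finset.mem_image_of_mem _ hx⟩
    _ ≤ 2 * (X.image Prod.snd).card := by
        rw [Finset.card_product]
        exact Nat.mul_le_mul_right _ Finset.card_le_two

theorem mem_outerBoundary_of_fst (hG : rookGraph 4 n ≤ H) (hX : IsTwoRowLobe H a b X)
    {z : Fin 4 × Fin n} (hz : z ∉ X) (hr : z.1 = a ∨ z.1 = b) : z ∈ outerBoundary H X := by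
  obtain ⟨j, hj⟩ := hX.exists_left
  obtain ⟨k, hk⟩ := hX.exists_right
  rcases hr with hr | hr
  · exact ⟨hz, _, hj, adj_of_fst_eq hG hr.symm (by rintro rfl; exact hz hj)⟩
  · exact ⟨hz, _, hk, adj_of_fst_eq hG hr.symm (by rintro rfl; exact hz hk)⟩

theorem isClique_product (hG : rookGraph 4 n ≤ H) (hX : IsTwoRowLobe H a b X) :
    H.IsClique ((({a, b} : Finset (Fin 4)) ×ˢ (X.image Prod.snd)ᶜ : Finset (Fin 4 × Fin n)) :
      Set (Fin 4 × Fin n)) := by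
  refine hX.isClique_outerBoundary.subset fun z hz => ?_
  rw [Finset.mem_coe, Finset.mem_product, Finset.mem_compl] at hz
  exact hX.mem_outerBoundary_of_fst hG (fun h => hz.2 (Finset.mem_image_of_mem _ h))
    (by simpa using hz.1)

/-- The outer boundary of a two-row lobe contains the rest of its rows and the other vertices of its
columns; a vertex of the lobe complete to the boundary can be added. -/
theorem exists_isClique_card_add (hG : rookGraph 4 n ≤ H) (hH : IsChordalGraph H) (hab : a ≠ b)
    (hX : IsTwoRowLobe H a b X) : ∃ K : Finset (Fin 4 × Fin n), H.IsClique K ∧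
      K.card + X.card = 2 * n + 2 * (X.image Prod.snd).card + 1 := by
  obtain ⟨v, hv, hvN⟩ := hX.exists_forall_adj hH
  have hsub : ∀ x ∈ X, x ∈ ({a, b} : Finset (Fin 4)) ×ˢ (Finset.univ : Finset (Fin n)) :=
    fun x hx => by simpa using hX.fst_eq_or x hx
  set K₁ := (({a, b} : Finset (Fin 4)) ×ˢ (Finset.univ : Finset (Fin n))) \ X with hK₁
  set K₂ := ({a, b} : Finset (Fin 4))ᶜ ×ˢ X.image Prod.snd with hK₂
  have hN : ∀ z ∈ K₁ ∪ K₂, z ∈ outerBoundary H X := by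
    intro z hz
    rw [Finset.mem_union] at hz
    rcases hz with hz | hz
    · rw [hK₁, Finset.mem_sdiff] at hz
      exact hX.mem_outerBoundary_of_fst hG hz.2 (by simpa using hz.1)
    · rw [hK₂, Finset.mem_product, Finset.mem_image] at hz
      obtain ⟨h1, x, hx, hxz⟩ := hz
      have hzX : z ∉ X := fun h => Finset.mem_compl.1 h1 (by simpa using hX.fst_eq_or z h)
      exact ⟨hzX, x, hx, adj_of_snd_eq hG hxz (by rintro rfl; exact hzX hx)⟩
  have hvK : v ∉ K₁ ∪ K₂ := fun h => (hN v h).1 hv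
  refine ⟨insert v (K₁ ∪ K₂), ?_, ?_⟩
  · rw [Finset.coe_insert, isClique_insert]
    exact ⟨hX.isClique_outerBoundary.subset hN, fun z hz _ => hvN z (hN z hz)⟩
  · have hdisj : Disjoint K₁ K₂ := by
      rw [Finset.disjoint_left]
      intro z hz hz'
      rw [hK₁, Finset.mem_sdiff, Finset.mem_product] at hz
      rw [hK₂, Finset.mem_product, Finset.mem_compl] at hz'
      exact hz'.1 hz.1.1
    have h1 : K₁.card + X.card = 2 * n := by
      rw [hK₁, Finset.card_sdiff_add_card_eq_card hsub, Finset.card_product, Finset.card_pair hab,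
        Finset.card_univ, Fintype.card_fin]
    have h2 : K₂.card = 2 * (X.image Prod.snd).card := by
      rw [hK₂, Finset.card_product, Finset.card_compl, Finset.card_pair hab, Fintype.card_fin]
    rw [Finset.card_insert_of_notMem hvK, Finset.card_union_of_disjoint hdisj]
    lia

/-- A two-row lobe with more vertices than columns, even after the removal of one, remains a two-row
lobe when a vertex complete to the outer boundary is removed: some column still meets both rows. -/
theorem exists_erase (hG : rookGraph 4 n ≤ H) (hH : IsChordalGraph H)
    (hX : IsTwoRowLobe H a b X) (hcard : (X.image Prod.snd).card + 2 ≤ X.card) :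
    ∃ v ∈ X, IsTwoRowLobe H a b (X.erase v) := by
  classical
  obtain ⟨v, hv, hvN⟩ := hX.exists_forall_adj hH
  have hfst : ∀ x ∈ X.erase v, x.1 = a ∨ x.1 = b := fun x hx =>
    hX.fst_eq_or x (Finset.mem_of_mem_erase hx)
  obtain ⟨x, hx, y, hy, hxy, hsnd⟩ := Finset.exists_ne_map_eq_of_card_lt_of_maps_to
    (s := X.erase v) (t := X.image Prod.snd) (f := Prod.snd)
    (by rw [Finset.card_erase_of_mem hv]; lia)
    (fun x hx => Finset.mem_image_of_mem _ (Finset.mem_of_mem_erase hx))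
  obtain ⟨j, haj, hbj⟩ : ∃ j, (a, j) ∈ X.erase v ∧ (b, j) ∈ X.erase v := by
    obtain ⟨x1, x2⟩ := x
    obtain ⟨y1, y2⟩ := y
    obtain rfl : x2 = y2 := hsnd
    refine ⟨x2, ?_⟩
    rcases hfst _ hx with h | h <;> rcases hfst _ hy with h' | h' <;> simp only at h h' <;>
      subst h <;> subst h'
    · exact absurd rfl hxy
    · exact ⟨hx, hy⟩
    · exact ⟨hy, hx⟩
    · exact absurd rfl hxy
  have hto : ∀ u ∈ X.erase v, ∃ w : H.Walk u (a, j), ∀ z ∈ w.support, z ∈ X.erase v := by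
    have h1 : ∀ (u t : Fin 4 × Fin n), u ∈ X.erase v → t ∈ X.erase v →
        (u.1 = t.1 ∨ u.2 = t.2) → ∃ w : H.Walk u t, ∀ z ∈ w.support, z ∈ X.erase v := by
      intro u t hu ht h
      by_cases hut : u = t
      · subst hut
        exact ⟨Walk.nil, by simpa using hu⟩
      · have hadj : H.Adj u t := h.elim (fun h => adj_of_fst_eq hG h hut)
          (fun h => adj_of_snd_eq hG h hut)
        refine ⟨Walk.cons hadj Walk.nil, fun z hz => ?_⟩
        rw [Walk.support_cons, Walk.support_nil, List.mem_cons, List.mem_singleton] at hz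
        rcases hz with rfl | rfl
        · exact hu
        · exact ht
    intro u hu
    rcases hfst u hu with h | h
    · exact h1 u _ hu haj (Or.inl h)
    · obtain ⟨w₁, hw₁⟩ := h1 u _ hu hbj (Or.inl h)
      obtain ⟨w₂, hw₂⟩ := h1 _ _ hbj haj (Or.inr rfl)
      refine ⟨w₁.append w₂, fun z hz => ?_⟩
      rw [Walk.mem_support_append_iff] at hz
      exact hz.elim (hw₁ z) (hw₂ z)
  refine ⟨v, hv, ⟨⟨⟨_, haj⟩, ?_, ?_⟩, hfst, ⟨j, haj⟩, ⟨j, hbj⟩⟩⟩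
  · intro s hs t ht
    obtain ⟨w₁, hw₁⟩ := hto s hs
    obtain ⟨w₂, hw₂⟩ := hto t ht
    refine ⟨w₁.append w₂.reverse, fun z hz => ?_⟩
    rw [Walk.mem_support_append_iff, Walk.support_reverse, List.mem_reverse] at hz
    exact hz.elim (hw₁ z) (hw₂ z)
  · have hB : H.IsClique (insert v (outerBoundary H X)) := by
      rw [isClique_insert]
      exact ⟨hX.isClique_outerBoundary, fun b hb _ => hvN b hb⟩
    refine hB.subset ?_
    rintro z ⟨hz, x, hx, hxz⟩
    by_cases hzv : z = v
    · exact Or.inl hzv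
    · exact Or.inr ⟨fun h => hz (Finset.mem_erase.2 ⟨hzv, h⟩), x, Finset.mem_of_mem_erase hx, hxz⟩

/-- If cliques have at most `2n + 2` vertices, two-row lobes shrink to lobes occupying at most two
columns, and the outer boundary of such a lobe contains all other columns of its rows. -/
theorem exists_isClique_product (hG : rookGraph 4 n ≤ H) (hH : IsChordalGraph H) (hab : a ≠ b)
    (hω : ∀ K : Finset (Fin 4 × Fin n), H.IsClique K → K.card ≤ 2 * n + 2)
    (hX : IsTwoRowLobe H a b X) : ∃ Z : Finset (Fin n), n ≤ Z.card + 2 ∧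
      H.IsClique ((({a, b} : Finset (Fin 4)) ×ˢ Z : Finset (Fin 4 × Fin n)) :
        Set (Fin 4 × Fin n)) := by
  induction hN : X.card generalizing X with
  | zero => exact absurd (Finset.card_eq_zero.1 hN) hX.nonempty.ne_empty
  | succ N ih =>
    by_cases hp : (X.image Prod.snd).card ≤ 2
    · refine ⟨(X.image Prod.snd)ᶜ, ?_, hX.isClique_product hG⟩
      rw [Finset.card_compl, Fintype.card_fin]
      lia
    · obtain ⟨K, hK, hcard⟩ := hX.exists_isClique_card_add hG hH hab
      have := hω K hK
      obtain ⟨v, hv, hXv⟩ := hX.exists_erase hG hH (by lia)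
      exact ih hXv (by rw [Finset.card_erase_of_mem hv]; lia)

/-- If cliques have at most `2n + 1` vertices, every two-row lobe consists of full columns; removing
a vertex would break the parity unless there is only one column. -/
theorem card_image_snd_le_one (hG : rookGraph 4 n ≤ H) (hH : IsChordalGraph H) (hab : a ≠ b)
    (hω : ∀ K : Finset (Fin 4 × Fin n), H.IsClique K → K.card ≤ 2 * n + 1)
    (hX : IsTwoRowLobe H a b X) : (X.image Prod.snd).card ≤ 1 := by
  have heven : ∀ Y, IsTwoRowLobe H a b Y → Y.card = 2 * (Y.image Prod.snd).card := by
    intro Y hY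
    obtain ⟨K, hK, hcard⟩ := hY.exists_isClique_card_add hG hH hab
    have := hω K hK
    have := hY.card_le
    lia
  by_contra hp
  have h1 := heven X hX
  obtain ⟨v, hv, hXv⟩ := hX.exists_erase hG hH (by lia)
  have h2 := heven _ hXv
  rw [Finset.card_erase_of_mem hv] at h2
  lia

end IsTwoRowLobe

end Rook

/-! ### Two disjoint pairs of rows that are almost cliques -/

section Rook

variable {n : ℕ} {H : SimpleGraph (Fin 4 × Fin n)}

theorem isTwoRowLobe_componentOff (hG : rookGraph 4 n ≤ H) {B : Finset (Fin 4 × Fin n)}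
    (hB : H.IsClique B) (hB2 : ∀ u ∉ B, ((componentOff H B u).image Prod.fst).card ≤ 2)
    {a b : Fin 4} (hab : a ≠ b) {j : Fin n} (ha : (a, j) ∉ B) (hb : (b, j) ∉ B) :
    IsTwoRowLobe H a b (componentOff H B (a, j)) := by
  have haX : (a, j) ∈ componentOff H B (a, j) := self_mem_componentOff ha
  have hbX : (b, j) ∈ componentOff H B (a, j) :=
    mem_componentOff_of_adj haX (adj_of_snd_eq hG rfl (by simpa using hab)) hb
  refine ⟨isLobe_componentOff hB ha, fun x hx => ?_, ⟨j, haX⟩, ⟨j, hbX⟩⟩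
  have hsub : ({a, b} : Finset (Fin 4)) ⊆ (componentOff H B (a, j)).image Prod.fst := by
    intro r hr
    rw [Finset.mem_insert, Finset.mem_singleton] at hr
    rcases hr with rfl | rfl
    · exact Finset.mem_image_of_mem _ haX
    · exact Finset.mem_image_of_mem _ hbX
  have heq := Finset.eq_of_subset_of_card_le hsub
    (by rw [Finset.card_pair hab]; exact hB2 _ ha)
  have hx1 : x.1 ∈ (componentOff H B (a, j)).image Prod.fst := Finset.mem_image_of_mem _ hx
  rw [← heq] at hx1
  simpa using hx1

theorem IsTwoRowLobe.mem_componentOff_of_fst (hG : rookGraph 4 n ≤ H)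
    {B : Finset (Fin 4 × Fin n)} {a b : Fin 4} {u z : Fin 4 × Fin n}
    (hX : IsTwoRowLobe H a b (componentOff H B u)) (hz : z ∉ B) (hr : z.1 = a ∨ z.1 = b) :
    z ∈ componentOff H B u := by
  by_contra h
  obtain ⟨-, x, hx, hxz⟩ := hX.mem_outerBoundary_of_fst hG h hr
  exact h (mem_componentOff_of_adj hx hxz hz)

theorem exists_same_column {S : Finset (Fin 4 × Fin n)} (hS : (S.image Prod.snd).card < S.card) :
    ∃ (a b : Fin 4) (j : Fin n), a ≠ b ∧ (a, j) ∈ S ∧ (b, j) ∈ S := by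
  obtain ⟨⟨a, j⟩, hx, ⟨b, k⟩, hy, hxy, hsnd⟩ := Finset.exists_ne_map_eq_of_card_lt_of_maps_to hS
    (fun x hx => Finset.mem_image_of_mem Prod.snd hx)
  obtain rfl : j = k := hsnd
  exact ⟨a, b, j, fun h => hxy (by rw [h]), hx, hy⟩

theorem exists_same_column_of_lt {S : Finset (Fin 4 × Fin n)} (hS : n < S.card) :
    ∃ (a b : Fin 4) (j : Fin n), a ≠ b ∧ (a, j) ∈ S ∧ (b, j) ∈ S :=
  exists_same_column (((Finset.card_le_univ _).trans_eq (Fintype.card_fin n)).trans_lt hS)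

/-- Every chordal supergraph of the `4 × n` rook's graph has a clique with `2n + 2` vertices.
Otherwise each two-row component left by a central clique has at most two vertices; there are at
most two of them, which is too few. -/
theorem exists_isClique_two_mul_add_two_le_card (hn : 4 ≤ n) (hG : rookGraph 4 n ≤ H)
    (hH : IsChordalGraph H) :
    ∃ K : Finset (Fin 4 × Fin n), H.IsClique K ∧ 2 * n + 2 ≤ K.card := by
  by_contra! hω
  replace hω : ∀ K : Finset (Fin 4 × Fin n), H.IsClique K → K.card ≤ 2 * n + 1 :=
    fun K hK => Nat.le_of_lt_succ (hω K hK)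
  obtain ⟨B, hB, hB2⟩ := exists_isClique_forall_card_rows_le_two hG hH
  have hBc : Bᶜ.card + B.card = 4 * n := by
    rw [Finset.card_compl_add_card]; simp
  have hBle := hω B hB
  have hsmall : ∀ (a b : Fin 4) (j : Fin n), a ≠ b → (a, j) ∈ Bᶜ → (b, j) ∈ Bᶜ →
      {z ∈ Bᶜ | z.1 = a ∨ z.1 = b}.card ≤ 2 := by
    intro a b j hab ha hb
    have hX := isTwoRowLobe_componentOff hG hB hB2 hab (Finset.mem_compl.1 ha)
      (Finset.mem_compl.1 hb)
    have h1 := hX.card_image_snd_le_one hG hH hab hω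
    have h2 := hX.card_le
    refine (Finset.card_le_card fun z hz => ?_).trans (h2.trans (by lia))
    rw [Finset.mem_filter, Finset.mem_compl] at hz
    exact hX.mem_componentOff_of_fst hG hz.1 hz.2
  obtain ⟨a, b, j, hab, ha, hb⟩ := exists_same_column_of_lt (S := Bᶜ) (by lia)
  have h1 := hsmall a b j hab ha hb
  have h2 := Finset.card_filter_add_card_filter_not (s := Bᶜ) (fun z => z.1 = a ∨ z.1 = b)
  obtain ⟨c, d, k, hcd, hc, hd⟩ :=
    exists_same_column_of_lt (S := {z ∈ Bᶜ | ¬ (z.1 = a ∨ z.1 = b)}) (by lia)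
  rw [Finset.mem_filter] at hc hd
  have h3 := hsmall c d k hcd hc.1 hd.1
  have h4 : ∀ a b c d x : Fin 4, a ≠ b → c ≠ d → ¬ (c = a ∨ c = b) → ¬ (d = a ∨ d = b) →
      ¬ (x = a ∨ x = b) → (x = c ∨ x = d) := by decide
  have h5 : {z ∈ Bᶜ | ¬ (z.1 = a ∨ z.1 = b)}.card ≤ {z ∈ Bᶜ | z.1 = c ∨ z.1 = d}.card := by
    refine Finset.card_le_card fun z hz => ?_
    rw [Finset.mem_filter] at hz ⊢
    exact ⟨hz.1, h4 a b c d z.1 hab hcd hc.2 hd.2 hz.2⟩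
  lia

/-- If cliques have at most `2n + 2` vertices, then two disjoint pairs of rows are cliques outside
at most two columns each. One pair carries a two-row component left by a central clique `B`. The
other pair either carries one as well, or it meets `B` in all but at most two columns. -/
theorem exists_two_isClique_product (hn : 3 ≤ n) (hG : rookGraph 4 n ≤ H)
    (hH : IsChordalGraph H)
    (hω : ∀ K : Finset (Fin 4 × Fin n), H.IsClique K → K.card ≤ 2 * n + 2) :
    ∃ (R S : Finset (Fin 4)) (Y Z : Finset (Fin n)), R.card = 2 ∧ S.card = 2 ∧ Disjoint R S ∧
      n ≤ Y.card + 2 ∧ n ≤ Z.card + 2 ∧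
      H.IsClique ((R ×ˢ Y : Finset (Fin 4 × Fin n)) : Set (Fin 4 × Fin n)) ∧
      H.IsClique ((S ×ˢ Z : Finset (Fin 4 × Fin n)) : Set (Fin 4 × Fin n)) := by
  obtain ⟨B, hB, hB2⟩ := exists_isClique_forall_card_rows_le_two hG hH
  have hBc : Bᶜ.card + B.card = 4 * n := by
    rw [Finset.card_compl_add_card]; simp
  have hBle := hω B hB
  obtain ⟨a, b, j, hab, ha, hb⟩ := exists_same_column_of_lt (S := Bᶜ) (by lia)
  have hX := isTwoRowLobe_componentOff hG hB hB2 hab (Finset.mem_compl.1 ha)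
    (Finset.mem_compl.1 hb)
  obtain ⟨Y, hY, hYc⟩ := hX.exists_isClique_product hG hH hab hω
  set X := componentOff H B (a, j) with hXdef
  set L := {z ∈ Bᶜ | ¬ (z.1 = a ∨ z.1 = b)} with hL
  by_cases hinj : (L.image Prod.snd).card < L.card
  · obtain ⟨c, d, k, hcd, hc, hd⟩ := exists_same_column hinj
    rw [hL, Finset.mem_filter, Finset.mem_compl] at hc hd
    obtain ⟨Z, hZ, hZc⟩ := (isTwoRowLobe_componentOff hG hB hB2 hcd hc.1
      hd.1).exists_isClique_product hG hH hcd hω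
    refine ⟨{a, b}, {c, d}, Y, Z, Finset.card_pair hab, Finset.card_pair hcd, ?_, hY, hZ,
      hYc, hZc⟩
    rw [Finset.disjoint_right]
    intro x hx
    rw [Finset.mem_insert, Finset.mem_singleton] at hx ⊢
    rcases hx with rfl | rfl
    · exact hc.2
    · exact hd.2
  -- The columns of `X` contribute at most two uncovered vertices each, and the `q` columns with an
  -- uncovered vertex in another row at most one each, so `2n - 2 ≤ 2 (n - q) + q`, that is `q ≤ 2`.
  · have hdisj : Disjoint (X.image Prod.snd) (L.image Prod.snd) := by
      rw [Finset.disjoint_left]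
      intro i hi hi'
      rw [Finset.mem_image] at hi hi'
      obtain ⟨x, hx, rfl⟩ := hi
      obtain ⟨y, hy, hyx⟩ := hi'
      rw [hL, Finset.mem_filter, Finset.mem_compl] at hy
      refine hy.2 (hX.fst_eq_or y (mem_componentOff_of_adj hx
        (adj_of_snd_eq hG hyx.symm ?_) hy.1))
      rintro rfl
      exact hy.2 (hX.fst_eq_or x hx)
    have h1 := Finset.card_le_univ (X.image Prod.snd ∪ L.image Prod.snd)
    rw [Finset.card_union_of_disjoint hdisj, Fintype.card_fin] at h1
    have h2 := Finset.card_filter_add_card_filter_not (s := Bᶜ) (fun z => z.1 = a ∨ z.1 = b)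
    have h3 : {z ∈ Bᶜ | z.1 = a ∨ z.1 = b}.card ≤ X.card := Finset.card_le_card fun z hz => by
      rw [Finset.mem_filter, Finset.mem_compl] at hz
      exact hX.mem_componentOff_of_fst hG hz.1 hz.2
    have h4 := hX.card_le
    have h5 : (L.image Prod.snd)ᶜ.card + (L.image Prod.snd).card = n := by
      rw [Finset.card_compl_add_card, Fintype.card_fin]
    refine ⟨{a, b}, {a, b}ᶜ, Y, (L.image Prod.snd)ᶜ, Finset.card_pair hab, ?_, disjoint_compl_right,
      hY, by lia, hYc, hB.subset fun z hz => ?_⟩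
    · rw [Finset.card_compl, Finset.card_pair hab, Fintype.card_fin]
    · rw [Finset.mem_coe, Finset.mem_product, Finset.mem_compl, Finset.mem_compl] at hz
      by_contra hzB
      refine hz.2 (Finset.mem_image_of_mem _ ?_)
      rw [hL, Finset.mem_filter, Finset.mem_compl]
      exact ⟨hzB, by simpa using hz.1⟩

end Rook

/-! ### Counting edges through the four-cycles spanned by two rows and two columns -/

section Counting

variable {n : ℕ} {H : SimpleGraph (Fin 4 × Fin n)}

open Classical in
/-- The number of diagonals present in `H` among the two diagonals of the four-cycle spanned by the
rows `r`, `s` and the columns `i`, `j`. In the degenerate cases `r = s` or `i = j` both diagonals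
are the same pair of vertices, up to order, and it is counted twice. -/
noncomputable def diagonalCount (H : SimpleGraph (Fin 4 × Fin n)) (i j : Fin n) (r s : Fin 4) : ℕ :=
  (if H.Adj (r, i) (s, j) then 1 else 0) + (if H.Adj (r, j) (s, i) then 1 else 0)

/-- The least value of `diagonalCount` for a chordal supergraph of the rook's graph. -/
def baseCount (i j : Fin n) (r s : Fin 4) : ℕ :=
  if r = s then (if i = j then 0 else 2) else (if i = j then 2 else 1)

/-- Every edge is counted four times: in each of its two directions, and as either of the two
diagonals. -/
theorem four_mul_ncard_edgeSet (H : SimpleGraph (Fin 4 × Fin n)) :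
    4 * H.edgeSet.ncard = ∑ i, ∑ j, ∑ r, ∑ s, diagonalCount H i j r s := by
  classical
  have h1 : 2 * H.edgeSet.ncard = ∑ i, ∑ j, ∑ r, ∑ s, (if H.Adj (r, i) (s, j) then 1 else 0) := by
    rw [Set.ncard_eq_toFinset_card', ← SimpleGraph.edgeFinset, ← sum_degrees_eq_twice_card_edges]
    simp_rw [← card_neighborFinset_eq_degree, neighborFinset_eq_filter, Finset.card_filter,
      Fintype.sum_prod_type]
    rw [Finset.sum_comm]
    refine Finset.sum_congr rfl fun i _ => ?_
    exact (Finset.sum_congr rfl fun r _ => Finset.sum_comm).trans Finset.sum_comm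
  have h2 : 2 * H.edgeSet.ncard = ∑ i, ∑ j, ∑ r, ∑ s, (if H.Adj (r, j) (s, i) then 1 else 0) := by
    rw [h1, Finset.sum_comm]
  simp only [diagonalCount, Finset.sum_add_distrib]
  lia

theorem sum_baseCount_rows (i j : Fin n) :
    ∑ r, ∑ s, baseCount i j r s = if i = j then 24 else 20 := by
  unfold baseCount
  split_ifs <;> decide

theorem sum_baseCount (n : ℕ) :
    ∑ i : Fin n, ∑ j, ∑ r, ∑ s, baseCount i j r s = 20 * n ^ 2 + 4 * n := by
  have h : ∀ i j : Fin n, (if i = j then 24 else 20) = 20 + if i = j then 4 else 0 := by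
    intro i j; split_ifs <;> rfl
  simp only [sum_baseCount_rows, h, Finset.sum_add_distrib, Finset.sum_const, Finset.card_univ,
    Fintype.card_fin, Finset.sum_ite_eq, Finset.mem_univ, if_true, smul_eq_mul]
  ring

/-- A four-cycle spanned by two rows and two columns has a diagonal. -/
theorem IsChordalGraph.adj_or_adj (hG : rookGraph 4 n ≤ H) (hH : IsChordalGraph H)
    {r s : Fin 4} {i j : Fin n} (hrs : r ≠ s) (hij : i ≠ j) :
    H.Adj (r, i) (s, j) ∨ H.Adj (r, j) (s, i) := by
  have h1 : H.Adj (r, i) (s, i) := adj_of_snd_eq hG rfl (by simpa using hrs)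
  have h2 : H.Adj (r, j) (s, j) := adj_of_snd_eq hG rfl (by simpa using hrs)
  have h3 : H.Adj (r, i) (r, j) := adj_of_fst_eq hG rfl (by simpa using hij)
  have h4 : H.Adj (s, i) (s, j) := adj_of_fst_eq hG rfl (by simpa using hij)
  obtain ⟨z, hz, hxz, hyz⟩ := hH.exists_common_neighbor_of_walk h1 (Walk.cons h2 Walk.nil) h3 h4
    (by simp [hrs, hij]) (by simp [hij, hrs.symm])
  simp only [Walk.support_cons, Walk.support_nil, List.mem_cons, List.not_mem_nil, or_false] at hz
  rcases hz with rfl | rfl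
  · exact Or.inr hyz.symm
  · exact Or.inl hxz

theorem baseCount_add_le_diagonalCount (hG : rookGraph 4 n ≤ H) (hH : IsChordalGraph H)
    {R S : Finset (Fin 4)} {Y Z : Finset (Fin n)} (hRS : Disjoint R S)
    (hY : H.IsClique ((R ×ˢ Y : Finset (Fin 4 × Fin n)) : Set (Fin 4 × Fin n)))
    (hZ : H.IsClique ((S ×ˢ Z : Finset (Fin 4 × Fin n)) : Set (Fin 4 × Fin n)))
    (i j : Fin n) (r s : Fin 4) :
    baseCount i j r s + ((if (i, j) ∈ Y.offDiag ∧ (r, s) ∈ R.offDiag then 1 else 0) +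
      (if (i, j) ∈ Z.offDiag ∧ (r, s) ∈ S.offDiag then 1 else 0)) ≤ diagonalCount H i j r s := by
  have hclique : ∀ {R : Finset (Fin 4)} {Y : Finset (Fin n)},
      H.IsClique ((R ×ˢ Y : Finset (Fin 4 × Fin n)) : Set (Fin 4 × Fin n)) →
      (i, j) ∈ Y.offDiag ∧ (r, s) ∈ R.offDiag → H.Adj (r, i) (s, j) ∧ H.Adj (r, j) (s, i) := by
    rintro R Y hY ⟨h1, h2⟩
    rw [Finset.mem_offDiag] at h1 h2
    constructor <;> refine hY ?_ ?_ (by simp [h2.2.2]) <;> simp [h1, h2]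
  simp only [Finset.mem_offDiag] at hclique
  simp only [baseCount, diagonalCount, Finset.mem_offDiag]
  by_cases hrs : r = s
  · subst hrs
    by_cases hij : i = j
    · simp [hij]
    · have h1 : H.Adj (r, i) (r, j) := adj_of_fst_eq hG rfl (by simpa using hij)
      simp [hij, h1, h1.symm]
  · by_cases hij : i = j
    · subst hij
      have h1 : H.Adj (r, i) (s, i) := adj_of_snd_eq hG rfl (by simpa using hrs)
      simp [hrs, h1]
    · by_cases h1 : (i ∈ Y ∧ j ∈ Y ∧ i ≠ j) ∧ r ∈ R ∧ s ∈ R ∧ r ≠ s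
      · have h2 : r ∉ S := Finset.disjoint_left.1 hRS h1.2.1
        obtain ⟨h3, h4⟩ := hclique hY h1
        simp [h1, h2, h3, h4]
      · by_cases h2 : (i ∈ Z ∧ j ∈ Z ∧ i ≠ j) ∧ r ∈ S ∧ s ∈ S ∧ r ≠ s
        · obtain ⟨h3, h4⟩ := hclique hZ h2
          rw [if_neg h1, if_pos h2, if_pos h3, if_pos h4, if_neg hrs, if_neg hij]
        · rw [if_neg h1, if_neg h2, if_neg hrs, if_neg hij]
          rcases hH.adj_or_adj hG hrs hij with h | h
          · rw [if_pos h]; lia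
          · rw [if_pos h]; lia

theorem sum_offDiag (R : Finset (Fin 4)) (Y : Finset (Fin n)) :
    ∑ i, ∑ j, ∑ r, ∑ s, (if (i, j) ∈ Y.offDiag ∧ (r, s) ∈ R.offDiag then 1 else 0) =
      Y.offDiag.card * R.offDiag.card := by
  have h : ∀ (i j : Fin n), ∑ r, ∑ s, (if (i, j) ∈ Y.offDiag ∧ (r, s) ∈ R.offDiag then 1 else 0) =
      (if (i, j) ∈ Y.offDiag then 1 else 0) * R.offDiag.card := by
    intro i j
    by_cases h : (i, j) ∈ Y.offDiag
    · simp only [h, true_and, if_true, one_mul]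
      rw [← Fintype.sum_prod_type' (fun r s => if (r, s) ∈ R.offDiag then 1 else 0)]
      simp only [Prod.mk.eta, Finset.sum_boole, Finset.filter_univ_mem, Nat.cast_id]
    · simp [h]
  simp only [h, ← Finset.sum_mul]
  congr 1
  rw [← Fintype.sum_prod_type' (fun i j => if (i, j) ∈ Y.offDiag then 1 else 0)]
  simp only [Prod.mk.eta, Finset.sum_boole, Finset.filter_univ_mem, Nat.cast_id]

/-- The edge count of a triangulation with cliques of size at most `2n + 2`, in the form `|E(H)| ≥
5n² + n + (n - 2)(n - 3)`. -/
theorem le_four_mul_ncard_edgeSet (hn : 3 ≤ n) (hG : rookGraph 4 n ≤ H) (hH : IsChordalGraph H)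
    (hω : ∀ K : Finset (Fin 4 × Fin n), H.IsClique K → K.card ≤ 2 * n + 2) :
    20 * n ^ 2 + 4 * n + 4 * ((n - 2) * (n - 3)) ≤ 4 * H.edgeSet.ncard := by
  obtain ⟨R, S, Y, Z, hR, hS, hRS, hYn, hZn, hY, hZ⟩ :=
    exists_two_isClique_product hn hG hH hω
  have key : ∀ W : Finset (Fin n), n ≤ W.card + 2 → (n - 2) * (n - 3) ≤ W.offDiag.card := by
    intro W hW
    rw [Finset.offDiag_card, ← Nat.mul_sub_one]
    exact Nat.mul_le_mul (by lia) (by lia)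
  have hsum := Finset.sum_le_sum fun i (_ : i ∈ Finset.univ) => Finset.sum_le_sum
    fun j (_ : j ∈ Finset.univ) => Finset.sum_le_sum fun r (_ : r ∈ Finset.univ) =>
    Finset.sum_le_sum fun s (_ : s ∈ Finset.univ) =>
    baseCount_add_le_diagonalCount hG hH hRS hY hZ i j r s
  rw [← four_mul_ncard_edgeSet] at hsum
  simp only [Finset.sum_add_distrib, sum_offDiag, sum_baseCount] at hsum
  rw [Finset.offDiag_card R, Finset.offDiag_card S, hR, hS] at hsum
  have h1 := key Y hYn
  have h2 := key Z hZn
  lia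

end Counting

/-! ### A triangulation with few edges -/

section Thin

/-- A triangulation of the `4 × n` rook's graph with few edges. Each column `i` is owned by the row
`i % 4`. The vertex of a column in the row that owns it is *private*; the other three are in the
core. Two private vertices are adjacent when they share a row. A private vertex is adjacent to a
core vertex in the same row, or in an earlier or equal column with the same owner. A core vertex
`(r, i)` is *special* when `r` and the owner of `i` differ by two, that is, when `r` and `i` have
the same parity; the core is complete except that special vertices in rows of different parity are
not adjacent. -/
def thinTriangulation (n : ℕ) : SimpleGraph (Fin 4 × Fin n) where
  Adj x y := x ≠ y ∧
    if x.2.val % 4 = x.1.val then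
      if y.2.val % 4 = y.1.val then x.1 = y.1
      else x.1 = y.1 ∨ (y.2.val % 4 = x.1.val ∧ y.2 ≤ x.2)
    else
      if y.2.val % 4 = y.1.val then x.1 = y.1 ∨ (x.2.val % 4 = y.1.val ∧ x.2 ≤ y.2)
      else x.2.val % 2 = x.1.val % 2 → y.2.val % 2 = y.1.val % 2 → x.1.val % 2 = y.1.val % 2
  symm := ⟨fun x y h => by
    refine ⟨h.1.symm, ?_⟩
    have h2 := h.2
    split_ifs at h2 ⊢ <;> grind⟩
  loopless := ⟨fun _ h => h.1 rfl⟩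

theorem rookGraph_le_thinTriangulation (n : ℕ) : rookGraph 4 n ≤ thinTriangulation n := by
  rintro ⟨r, i⟩ ⟨s, j⟩ h
  refine ⟨h.ne, ?_⟩
  simp only [rookGraph, boxProd_adj, top_adj] at h
  rcases h with ⟨h, rfl⟩ | ⟨h, rfl⟩
  · have : r.val ≠ s.val := fun h' => h (Fin.ext h')
    simp only
    split_ifs <;> grind
  · simp only
    split_ifs <;> grind

/-- Private vertices are eliminated first, ordered by column, then special ones, then the rest of
the core. -/
theorem isChordalGraph_thinTriangulation (n : ℕ) : IsChordalGraph (thinTriangulation n) := by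
  refine IsChordalGraph.of_rank (fun x : Fin 4 × Fin n => if x.2.val % 4 = x.1.val then x.2.val
    else if x.2.val % 2 = x.1.val % 2 then n else n + 1) ?_
  rintro ⟨r, i⟩ ⟨s, j⟩ ⟨t, k⟩ ⟨-, huv⟩ ⟨-, huw⟩ hvw h1 h2
  refine ⟨hvw, ?_⟩
  simp only [Fin.ext_iff, Fin.le_def] at *
  have := i.2; have := j.2; have := k.2
  generalize i.val = i at *; generalize j.val = j at *; generalize k.val = k at *
  have := r.2; have := s.2; have := t.2
  generalize r.val = r at *; generalize s.val = s at *; generalize t.val = t at *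
  clear hvw
  split_ifs at * <;> omega

/-- A four-cycle has both diagonals only if neither of its rows owns one of its columns and the
owners of its columns have the same parity. -/
theorem mod_four_of_adj_of_adj {n : ℕ} {i j : Fin n} {r s : Fin 4} (hij : i ≠ j) (hrs : r ≠ s)
    (h₁ : (thinTriangulation n).Adj (r, i) (s, j)) (h₂ : (thinTriangulation n).Adj (r, j) (s, i)) :
    i.val % 4 ≠ r ∧ i.val % 4 ≠ s ∧ j.val % 4 ≠ r ∧ j.val % 4 ≠ s ∧ i.val % 2 = j.val % 2 := by
  obtain ⟨-, h₁⟩ := h₁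
  obtain ⟨-, h₂⟩ := h₂
  simp only [Fin.ext_iff, Fin.le_def, ne_eq] at *
  have := r.2; have := s.2
  generalize i.val = i at *; generalize j.val = j at *
  generalize r.val = r at *; generalize s.val = s at *
  split_ifs at * <;> omega

/-- The indicator of the condition in `mod_four_of_adj_of_adj`, for columns given as natural
numbers. -/
def doubleCount (i j : ℕ) (r s : Fin 4) : ℕ :=
  if r ≠ s ∧ (i % 4 ≠ r ∧ i % 4 ≠ s ∧ j % 4 ≠ r ∧ j % 4 ≠ s ∧ i % 2 = j % 2) then 1 else 0

/-- A pair of columns with the same owner contributes the six ordered pairs of distinct other rows,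
a pair whose owners differ by two contributes the remaining two rows in either order. -/
theorem sum_doubleCount (i j : ℕ) : ∑ r, ∑ s, doubleCount i j r s =
    4 * (if i % 4 = j % 4 then 1 else 0) + 2 * (if i % 2 = j % 2 then 1 else 0) := by
  have key : ∀ a b : Fin 4, ∑ r, ∑ s, doubleCount a b r s =
      4 * (if a = b then 1 else 0) + 2 * (if a.val % 2 = b.val % 2 then 1 else 0) := by decide
  have h := key ⟨i % 4, Nat.mod_lt _ (by norm_num)⟩ ⟨j % 4, Nat.mod_lt _ (by norm_num)⟩
  simpa [doubleCount, Nat.mod_mod_of_dvd _ (show 2 ∣ 4 by norm_num)] using h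

/-- On the diagonal `i = j` the term `doubleCount` is added on both sides, so that the sums on the
right run over all pairs of columns. -/
theorem diagonalCount_thinTriangulation_le {n : ℕ} (i j : Fin n) (r s : Fin 4) :
    diagonalCount (thinTriangulation n) i j r s + (if i = j then doubleCount i j r s else 0) ≤
      baseCount i j r s + doubleCount i j r s := by
  have h2 : diagonalCount (thinTriangulation n) i j r s ≤ 2 := by
    unfold diagonalCount
    split_ifs <;> lia
  by_cases hij : i = j
  · subst hij
    by_cases hrs : r = s
    · subst hrs
      simp [diagonalCount, baseCount]
    · rw [if_pos rfl, baseCount, if_neg hrs, if_pos rfl]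
      lia
  · rw [if_neg hij]
    by_cases hrs : r = s
    · rw [baseCount, if_pos hrs, if_neg hij]
      lia
    · rw [baseCount, if_neg hrs, if_neg hij]
      by_cases h : (thinTriangulation n).Adj (r, i) (s, j) ∧ (thinTriangulation n).Adj (r, j) (s, i)
      · rw [doubleCount, if_pos ⟨hrs, mod_four_of_adj_of_adj hij hrs h.1 h.2⟩]
        lia
      · have h1 : diagonalCount (thinTriangulation n) i j r s ≤ 1 := by
          unfold diagonalCount
          by_cases h1 : (thinTriangulation n).Adj (r, i) (s, j)
          · rw [if_neg fun h2 => h ⟨h1, h2⟩, if_pos h1]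
          · rw [if_neg h1]
            split_ifs <;> lia
        lia

theorem sum_mod_four_add_sum_mod_two_le (n : ℕ) :
    4 * (∑ i ∈ Finset.range n, ∑ j ∈ Finset.range n, if i % 4 = j % 4 then 1 else 0) +
      2 * (∑ i ∈ Finset.range n, ∑ j ∈ Finset.range n, if i % 2 = j % 2 then 1 else 0) =
      2 * n ^ 2 + if n % 4 = 0 then 0 else 4 := by
  have hcount : ∀ m : ℕ, 0 < m → ∀ n : ℕ,
      (∑ j ∈ Finset.range n, if j % m = n % m then 1 else 0) = n / m := by
    intro m hm n
    have h := Nat.count_modEq_card n hm n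
    rw [if_neg (lt_irrefl _), add_zero, Nat.count_eq_card_filter_range] at h
    rw [← h, ← Finset.card_filter]
    rfl
  have hstep : ∀ m : ℕ, 0 < m → ∀ n : ℕ,
      (∑ i ∈ Finset.range (n + 1), ∑ j ∈ Finset.range (n + 1),
        if i % m = j % m then 1 else 0) =
      (∑ i ∈ Finset.range n, ∑ j ∈ Finset.range n, if i % m = j % m then 1 else 0) +
        2 * (n / m) + 1 := by
    intro m hm n
    have h1 := hcount m hm n
    have h2 : (∑ j ∈ Finset.range n, if n % m = j % m then 1 else 0) = n / m := by
      rw [← h1]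
      exact Finset.sum_congr rfl fun j _ => by simp only [eq_comm]
    simp only [Finset.sum_range_succ, Finset.sum_add_distrib, h1, h2, if_true]
    ring
  induction n with
  | zero => simp
  | succ n ih =>
    rw [hstep 4 (by norm_num), hstep 2 (by norm_num)]
    have : (n + 1) ^ 2 = n ^ 2 + 2 * n + 1 := by ring
    split_ifs at ih ⊢ <;> omega

/-- The edge count of the thin triangulation, in the form `|E| ≤ (11n² - n + 2) / 2`. -/
theorem four_mul_ncard_edgeSet_thinTriangulation_le (n : ℕ) :
    4 * (thinTriangulation n).edgeSet.ncard + 6 * n ≤ 22 * n ^ 2 + 4 * n + 4 := by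
  have hsum := Finset.sum_le_sum fun i (_ : i ∈ Finset.univ) => Finset.sum_le_sum
    fun j (_ : j ∈ Finset.univ) => Finset.sum_le_sum fun r (_ : r ∈ Finset.univ) =>
    Finset.sum_le_sum fun s (_ : s ∈ Finset.univ) =>
    diagonalCount_thinTriangulation_le (n := n) i j r s
  have hdiag : ∑ i : Fin n, ∑ j : Fin n, ∑ r, ∑ s,
      (if i = j then doubleCount i j r s else 0) = 6 * n := by
    have : ∀ i j : Fin n, ∑ r, ∑ s, (if i = j then doubleCount i j r s else 0) =
        if i = j then 6 else 0 := by
      intro i j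
      by_cases hij : i = j
      · subst hij
        simp [sum_doubleCount]
      · simp [hij]
    simp only [this, Finset.sum_ite_eq, Finset.mem_univ, if_true, Finset.sum_const, Finset.card_univ,
      Fintype.card_fin, smul_eq_mul, mul_comm]
  have hdouble : ∑ i : Fin n, ∑ j : Fin n, ∑ r, ∑ s, doubleCount i j r s ≤ 2 * n ^ 2 + 4 := by
    have h := sum_mod_four_add_sum_mod_two_le n
    simp only [sum_doubleCount, Finset.sum_add_distrib, ← Finset.mul_sum]
    simp only [Finset.sum_range] at h
    rw [h]
    split_ifs <;> lia
  rw [Finset.sum_congr rfl fun i _ => Finset.sum_congr rfl fun j _ => Finset.sum_congr rfl fun r _ =>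
    Finset.sum_add_distrib] at hsum
  simp only [Finset.sum_add_distrib, sum_baseCount, hdiag] at hsum
  rw [← four_mul_ncard_edgeSet] at hsum
  lia

end Thin

/-! ### The treewidth of the rook's graph -/

section Upper

theorem isTree_pathGraph (n : ℕ) : (pathGraph (n + 1)).IsTree := by
  refine ⟨pathGraph_connected n, IsAcyclic.of_rank Fin.val fun u v w huv huw h1 h2 => Fin.ext ?_⟩
  rw [pathGraph_adj] at huv huw
  lia

theorem preconnected_induce_pathGraph {n : ℕ} {S : Set (Fin n)} (hS : S.OrdConnected) :
    ((pathGraph n).induce S).Preconnected := by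
  have key : ∀ (d : ℕ) (u v : S), u.1.val + d = v.1.val → ((pathGraph n).induce S).Reachable u v := by
    intro d
    induction d with
    | zero =>
      intro u v h
      have : u = v := Subtype.ext (Fin.ext (by simpa using h))
      rw [this]
    | succ d ih =>
      intro u v h
      have hlt : u.1.val + 1 < n := by have := v.1.2; lia
      have hu : (⟨u.1.val + 1, hlt⟩ : Fin n) ∈ S :=
        hS.out u.2 v.2 ⟨Fin.le_def.2 (Nat.le_succ _), Fin.le_def.2 (by change u.1.val + 1 ≤ _; lia)⟩
      have hadj : ((pathGraph n).induce S).Adj u ⟨_, hu⟩ := by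
        simp [pathGraph_adj]
      exact hadj.reachable.trans (ih ⟨_, hu⟩ v (by simp; lia))
  intro u v
  rcases le_total u.1.val v.1.val with h | h
  · exact key (v.1.val - u.1.val) u v (by lia)
  · exact (key (u.1.val - v.1.val) v u (by lia)).symm

/-- The bags of the path decomposition that sweeps the columns: rows `0` and `1` from column `t` on,
rows `2` and `3` up to column `t`. -/
def sweepBag (n : ℕ) (t : Fin n) : Finset (Fin 4 × Fin n) :=
  {x | (x.1 < 2 ∧ t ≤ x.2) ∨ (2 ≤ x.1 ∧ x.2 ≤ t)}

theorem mem_sweepBag {n : ℕ} {t : Fin n} {x : Fin 4 × Fin n} :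
    x ∈ sweepBag n t ↔ (x.1 < 2 ∧ t ≤ x.2) ∨ (2 ≤ x.1 ∧ x.2 ≤ t) := by
  simp [sweepBag]

theorem self_mem_sweepBag {n : ℕ} (x : Fin 4 × Fin n) : x ∈ sweepBag n x.2 := by
  rw [mem_sweepBag]
  rcases lt_or_ge x.1 2 with h | h
  · exact Or.inl ⟨h, le_rfl⟩
  · exact Or.inr ⟨h, le_rfl⟩

theorem card_sweepBag {n : ℕ} (t : Fin n) : (sweepBag n t).card = 2 * n + 2 := by
  have h : sweepBag n t = (({0, 1} : Finset (Fin 4)) ×ˢ Finset.Ici t) ∪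
      (({2, 3} : Finset (Fin 4)) ×ˢ Finset.Iic t) := by
    have h1 : ∀ r : Fin 4, (r < 2 ↔ r = 0 ∨ r = 1) ∧ (2 ≤ r ↔ r = 2 ∨ r = 3) := by decide
    ext ⟨r, i⟩
    simp [mem_sweepBag, h1]
  rw [h, Finset.card_union_of_disjoint, Finset.card_product, Finset.card_product, Fin.card_Ici,
    Fin.card_Iic]
  · have := t.2
    simp only [Finset.card_pair (show (0 : Fin 4) ≠ 1 by decide),
      Finset.card_pair (show (2 : Fin 4) ≠ 3 by decide)]
    lia
  · rw [Finset.disjoint_left]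
    rintro ⟨r, i⟩ h1 h2
    rw [Finset.mem_product] at h1 h2
    revert h1 h2
    have : ∀ r : Fin 4, r ∈ ({0, 1} : Finset (Fin 4)) → r ∈ ({2, 3} : Finset (Fin 4)) → False := by
      decide
    exact fun h1 h2 => this r h1.1 h2.1

theorem isTreeDecomposition_sweepBag (n : ℕ) :
    IsTreeDecomposition (rookGraph 4 (n + 1)) (pathGraph (n + 1)) (sweepBag (n + 1)) := by
  refine ⟨isTree_pathGraph n, fun v => ⟨_, self_mem_sweepBag v⟩, ?_, fun v => ?_⟩
  · rintro ⟨r, i⟩ ⟨s, j⟩ h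
    simp only [rookGraph, boxProd_adj, top_adj] at h
    rcases h with ⟨-, rfl⟩ | ⟨-, rfl⟩
    · exact ⟨i, self_mem_sweepBag (r, i), self_mem_sweepBag (s, i)⟩
    · rcases lt_or_ge r 2 with hr | hr
      · exact ⟨0, mem_sweepBag.2 (Or.inl ⟨hr, Fin.zero_le _⟩),
          mem_sweepBag.2 (Or.inl ⟨hr, Fin.zero_le _⟩)⟩
      · exact ⟨Fin.last n, mem_sweepBag.2 (Or.inr ⟨hr, Fin.le_last _⟩),
          mem_sweepBag.2 (Or.inr ⟨hr, Fin.le_last _⟩)⟩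
  · have : Nonempty {t | v ∈ sweepBag (n + 1) t} := ⟨⟨_, self_mem_sweepBag v⟩⟩
    refine ⟨preconnected_induce_pathGraph ⟨fun s hs t ht u hu => ?_⟩⟩
    simp only [Set.mem_ofPred_eq, mem_sweepBag] at hs ht ⊢
    rcases lt_or_ge v.1 2 with hr | hr
    · have : t ≤ v.2 := by grind
      exact Or.inl ⟨hr, hu.2.trans this⟩
    · have : v.2 ≤ s := by grind
      exact Or.inr ⟨hr, this.trans hu.1⟩

theorem treewidth_rookGraph_four_le {n : ℕ} (hn : 0 < n) :
    treewidth (rookGraph 4 n) ≤ 2 * n + 1 := by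
  obtain ⟨n, rfl⟩ := Nat.exists_eq_add_one_of_ne_zero hn.ne'
  exact treewidth_le_of_isTreeDecomposition (isTreeDecomposition_sweepBag n)
    fun t => (card_sweepBag t).le

theorem treewidth_rookGraph_four {n : ℕ} (hn : 4 ≤ n) : treewidth (rookGraph 4 n) = 2 * n + 1 := by
  refine le_antisymm (treewidth_rookGraph_four_le (by lia)) ?_
  have : Nonempty (Fin 4 × Fin n) := ⟨(0, ⟨0, by lia⟩)⟩
  obtain ⟨H, hH, hω⟩ := exists_isTriangulation_isClique_card_le_treewidth (rookGraph 4 n)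
  obtain ⟨K, hK, hcard⟩ := exists_isClique_two_mul_add_two_le_card hn hH.1 hH.2
  have := hω K hK
  lia

end Upper

theorem mainTheorem1 (n : ℕ) (hn : 6 ≤ n) :
    treewidth (rookGraph 4 n) = 2 * n + 1 ∧
    (¬ ∃ H : SimpleGraph (Fin 4 × Fin n),
      IsMinimumTriangulation (rookGraph 4 n) H ∧ treewidth H = treewidth (rookGraph 4 n)) ∧
    0 < tau (rookGraph 4 n) := by
  have htw := treewidth_rookGraph_four (n := n) (by lia)
  have hmain : ¬ ∃ H : SimpleGraph (Fin 4 × Fin n),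
      IsMinimumTriangulation (rookGraph 4 n) H ∧ treewidth H = treewidth (rookGraph 4 n) := by
    rintro ⟨H, ⟨⟨hG, hH⟩, hmin⟩, heq⟩
    have : Nonempty (Fin 4 × Fin n) := ⟨(0, ⟨0, by lia⟩)⟩
    -- `H'` contains `H`, so its clique bound passes to `H`.
    obtain ⟨H', hH', hω⟩ := exists_isTriangulation_isClique_card_le_treewidth H
    have hlow := le_four_mul_ncard_edgeSet (by lia) hG hH fun K hK => by
      have := hω K (hK.mono hH'.1)
      lia
    have hup := four_mul_ncard_edgeSet_thinTriangulation_le n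
    have hle := hmin _ ⟨rookGraph_le_thinTriangulation n, isChordalGraph_thinTriangulation n⟩
    obtain ⟨m, rfl⟩ := Nat.exists_eq_add_of_le hn
    -- Both truncated subtractions are exact for `n = m + 6`.
    rw [show 6 + m - 2 = m + 4 by lia, show 6 + m - 3 = m + 3 by lia] at hlow
    nlinarith
  exact ⟨htw, hmain, tau_pos hmain⟩
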